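/- Let $\mathrm{Diff}^{2,\Delta}_+([0,1])$ denote the set of orientation-preserving $C^2$ diffeomorphisms of $[0,1]$ onto itself (with $C^2$ inverse, regularity at the endpoints being one-sided) that have no fixed point in the open interval $(0,1)$. For such an $f$, let $\mathrm{var}(\log Df^n)$ be the total variation on $[0,1]$ of the logarithm of the derivative of the $n$-th iterate $f^n$, and let $$\mathrm{dist}_\infty(f) := \lim_{n\to\infty} \frac{1}{n}\,\mathrm{var}(\log Df^n)$$ be the asymptotic distortion of $f$ (this limit exists and is finite). If $f$ and $g$ are commuting elements of $\mathrm{Diff}^{2,\Delta}_+([0,1])$, i.e. $f\circ g = g\circ f$, then $\mathrm{dist}_\infty(f)$ and $\mathrm{dist}_\infty(g)$ are either both zero or both strictly positive. -/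

import Mathlib

open Set Filter Topology
open scoped ENNReal

namespace IntervalDiffeo

/-- `IsDiffeo r f`: the restriction of `f` to `[0,1]` is an orientation-preserving `C^r`
diffeomorphism of `[0,1]` onto itself (regularity at the endpoints is one-sided). Only the values
of `f` on `[0,1]` matter. -/
structure IsDiffeo (r : WithTop ℕ∞) (f : ℝ → ℝ) : Prop where
  bijOn : BijOn f (Icc 0 1) (Icc 0 1)
  strictMonoOn : StrictMonoOn f (Icc 0 1)
  contDiffOn : ContDiffOn ℝ r f (Icc 0 1)
  exists_contDiffOn_inverse :
    ∃ h : ℝ → ℝ, InvOn h f (Icc 0 1) (Icc 0 1) ∧ ContDiffOn ℝ r h (Icc 0 1)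

/-- Orientation-preserving `C^r` diffeomorphisms of `[0,1]` with no fixed point in the interior. -/
structure IsDiffeoDelta (r : WithTop ℕ∞) (f : ℝ → ℝ) : Prop extends IsDiffeo r f where
  no_interior_fixed_point : ∀ x ∈ Ioo (0 : ℝ) 1, f x ≠ x

/-- `var (log Df)`: the total variation over `[0,1]` of the logarithm of the derivative. -/
noncomputable def varLogDeriv (f : ℝ → ℝ) : ℝ≥0∞ :=
  eVariationOn (fun x => Real.log (derivWithin f (Icc 0 1) x)) (Icc 0 1)

/-- The sequence `var (log D(f^n)) / n`, where `f^n` is the `n`-th iterate. -/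
noncomputable def distortionSeq (f : ℝ → ℝ) (n : ℕ) : ℝ≥0∞ :=
  varLogDeriv (f^[n]) / n

/-- The asymptotic distortion `dist_∞ (f) = lim_{n → ∞} var (log D(f^n)) / n`. -/
noncomputable def asymptoticDistortion (f : ℝ → ℝ) : ℝ≥0∞ :=
  limUnder atTop (distortionSeq f)

end IntervalDiffeo

/-! Write `c a = log Da`. Replacing `f` by its inverse does not change `var (log D(f^n))`, so both
maps may be assumed to move interior points towards 0. For interior `z, w` the increments of `c (f ^
n)` and of `c (f⁻¹ ^ n)` between `z` and `w` measure the distortion of `f` at the endpoints 0 and 1.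
Two facts carry the proof: `dist_∞ (f) = 0` exactly when the two distortions become asymptotically
equal (`Balanced`), and commuting contractions asymptotically share the distortion at each endpoint
(`tendsto_sub_of_commute`). Hence balance passes from `f` to `g`, and so does vanishing.

The estimates are of Denjoy–Kopell type: if `f ^ K • w ≤ z`, the images of `[z, w]` under the powers
of `f` overlap at most `K` times, which bounds the distortion of `f ^ n` uniformly in `n`, with a
small bound once the interval is near 0.

If balance fails on a fundamental domain, `c (f ^ n)` gains a definite amount on a number of
translates of that domain that grows linearly with `n` (`tendsto_of_tendsto_eVariationOn_div`). If
balance holds, all of the variation is bounded by sums of terms tending to 0, so it is `o(n)`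
(`tendsto_eVariationOn_div_of_balanced`). -/

namespace IntervalDiffeo

/-- A group acting on `[0,1]` by increasing bijections, together with a real cocycle each of whose
members is Lipschitz. The model case is a group of `C^2` diffeomorphisms with `c a = log Da`. -/
structure LipschitzCocycle {Γ : Type*} [Group Γ] [MulAction Γ unitInterval]
    (c : Γ → unitInterval → ℝ) : Prop where
  strictMono : ∀ a : Γ, StrictMono fun x : unitInterval => a • x
  map_mul : ∀ a b x, c (a * b) x = c a (b • x) + c b x
  lipschitz : ∀ a, ∃ C : ℝ, 0 ≤ C ∧ ∀ u v, |c a u - c a v| ≤ C * |(u : ℝ) - v|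

/-- The group element `f` moves every interior point of `[0,1]` to the left. -/
def Contracts {Γ : Type*} [Group Γ] [MulAction Γ unitInterval] (f : Γ) : Prop :=
  ∀ x : unitInterval, 0 < x → x < 1 → f • x < x

/-- The forward and backward distortions of `f` between two interior points become asymptotically
equal. -/
def Balanced {Γ : Type*} [Group Γ] (c : Γ → unitInterval → ℝ) (f : Γ) : Prop :=
  ∀ z w : unitInterval, 0 < z → z < 1 → 0 < w → w < 1 →
    Tendsto (fun n : ℕ => (c (f ^ n) z - c (f ^ n) w) - (c (f⁻¹ ^ n) z - c (f⁻¹ ^ n) w))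
      atTop (𝓝 0)

theorem balanced_of_le {Γ : Type*} [Group Γ] {c : Γ → unitInterval → ℝ} {f : Γ}
    (h : ∀ z w : unitInterval, 0 < z → w < 1 → z ≤ w →
      Tendsto (fun n : ℕ => (c (f ^ n) z - c (f ^ n) w) - (c (f⁻¹ ^ n) z - c (f⁻¹ ^ n) w))
        atTop (𝓝 0)) : Balanced c f := by
  intro z w hz0 hz1 hw0 hw1
  rcases le_total z w with hzw | hzw
  · exact h z w hz0 hw1 hzw
  · have := (h w z hw0 hz1 hzw).neg
    rw [neg_zero] at this
    exact this.congr fun n => by ring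

/-! ### Telescoping sums and semicontinuity of the variation -/

section Sequences

theorem sum_range_sub_shift (d : ℕ → ℝ) (K n : ℕ) :
    ∑ i ∈ Finset.range n, (d i - d (i + K)) =
      ∑ i ∈ Finset.range K, d i - ∑ i ∈ Finset.range K, d (i + n) := by
  induction n with
  | zero => simp
  | succ n ih =>
    have h := Finset.sum_range_succ' (fun i => d (i + n)) K
    rw [Finset.sum_range_succ] at h
    simp only [zero_add, add_right_comm _ 1 n] at h
    rw [Finset.sum_range_succ, ih, add_comm n K]
    simp only [← add_assoc] at h ⊢
    linarith

/-- The bound does not depend on `n`; this is the source of every uniform distortion estimate below.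
-/
theorem sum_range_sub_shift_le {d : ℕ → ℝ} (hd : ∀ i, 0 ≤ d i) (K n : ℕ) :
    ∑ i ∈ Finset.range n, (d i - d (i + K)) ≤ ∑ i ∈ Finset.range K, d i := by
  rw [sum_range_sub_shift]
  linarith [Finset.sum_nonneg fun i (_ : i ∈ Finset.range K) => hd (i + n)]

/-- A function whose increments are limits of increments controlled by monotone functions has
bounded variation. -/
theorem eVariationOn_le_of_tendsto {α : Type*} [LinearOrder α] {φ : α → ℝ} {s : Set α} {a b : α}
    (hs : ∀ x ∈ s, a ≤ x ∧ x ≤ b) {ψ : ℕ → α → α → ℝ} {T : ℕ → α → ℝ} {B : ℝ}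
    (hT : ∀ N, Monotone (T N)) (hB : ∀ᶠ N in atTop, T N b - T N a ≤ B)
    (hψ : ∀ u ∈ s, ∀ v ∈ s, u ≤ v → Tendsto (fun N => ψ N u v) atTop (𝓝 (φ u - φ v)))
    (hψT : ∀ᶠ N in atTop, ∀ u ∈ s, ∀ v ∈ s, u ≤ v → |ψ N u v| ≤ T N v - T N u) :
    eVariationOn φ s ≤ ENNReal.ofReal B := by
  refine iSup_le ?_
  rintro ⟨n, u, hu, hus⟩
  have h1 : ∑ i ∈ Finset.range n, edist (φ (u (i + 1))) (φ (u i)) =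
      ENNReal.ofReal (∑ i ∈ Finset.range n, |φ (u i) - φ (u (i + 1))|) := by
    rw [ENNReal.ofReal_sum_of_nonneg fun _ _ => abs_nonneg _]
    refine Finset.sum_congr rfl fun i _ => ?_
    rw [edist_comm, edist_dist, Real.dist_eq]
  change ∑ i ∈ Finset.range n, edist (φ (u (i + 1))) (φ (u i)) ≤ _
  rw [h1]
  refine ENNReal.ofReal_le_ofReal ?_
  -- With the partition fixed, its sum is a limit over `N` of sums dominated by telescoping
  -- increments of `T N`.
  have h2 : Tendsto (fun N => ∑ i ∈ Finset.range n, |ψ N (u i) (u (i + 1))|) atTop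
      (𝓝 (∑ i ∈ Finset.range n, |φ (u i) - φ (u (i + 1))|)) :=
    tendsto_finsetSum _ fun i _ => (hψ _ (hus _) _ (hus _) (hu (Nat.le_succ i))).abs
  refine le_of_tendsto h2 ?_
  filter_upwards [hB, hψT] with N hN1 hN2
  calc ∑ i ∈ Finset.range n, |ψ N (u i) (u (i + 1))|
      ≤ ∑ i ∈ Finset.range n, (T N (u (i + 1)) - T N (u i)) :=
        Finset.sum_le_sum fun i _ => hN2 _ (hus _) _ (hus _) (hu (Nat.le_succ i))
    _ = T N (u n) - T N (u 0) := Finset.sum_range_sub (fun i => T N (u i)) n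
    _ ≤ T N b - T N a := sub_le_sub (hT N (hs _ (hus n)).2) (hT N (hs _ (hus 0)).1)
    _ ≤ B := hN1

end Sequences

/-! ### Distortion estimates and commuting contractions -/

section Dynamics

variable {Γ : Type*} [Group Γ] [MulAction Γ unitInterval] {c : Γ → unitInterval → ℝ} {f g : Γ}

namespace LipschitzCocycle

theorem mono (hc : LipschitzCocycle c) (a : Γ) {x y : unitInterval} (h : x ≤ y) : a • x ≤ a • y :=
  (hc.strictMono a).monotone h

theorem smul_zero (hc : LipschitzCocycle c) (a : Γ) : a • (0 : unitInterval) = 0 := by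
  refine le_antisymm ?_ unitInterval.nonneg'
  simpa using hc.mono a (unitInterval.nonneg' : 0 ≤ a⁻¹ • (0 : unitInterval))

theorem smul_one (hc : LipschitzCocycle c) (a : Γ) : a • (1 : unitInterval) = 1 := by
  refine le_antisymm unitInterval.le_one' ?_
  simpa using hc.mono a (unitInterval.le_one' : a⁻¹ • (1 : unitInterval) ≤ 1)

theorem smul_pos (hc : LipschitzCocycle c) (a : Γ) {x : unitInterval} (h : 0 < x) : 0 < a • x := by
  simpa [hc.smul_zero] using hc.strictMono a h

theorem smul_lt_one (hc : LipschitzCocycle c) (a : Γ) {x : unitInterval} (h : x < 1) :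
    a • x < 1 := by
  simpa [hc.smul_one] using hc.strictMono a h

theorem continuous_smul (hc : LipschitzCocycle c) (a : Γ) :
    Continuous fun x : unitInterval => a • x :=
  (hc.strictMono a).monotone.continuous_of_surjective (MulAction.surjective a)

theorem smul_le (hc : LipschitzCocycle c) (hf : Contracts f) (x : unitInterval) : f • x ≤ x := by
  rcases (unitInterval.nonneg' : 0 ≤ x).eq_or_lt with rfl | h0
  · rw [hc.smul_zero]
  rcases (unitInterval.le_one' : x ≤ 1).eq_or_lt with rfl | h1
  · rw [hc.smul_one]
  exact (hf x h0 h1).le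

theorem le_inv_smul (hc : LipschitzCocycle c) (hf : Contracts f) (x : unitInterval) :
    x ≤ f⁻¹ • x := by
  simpa using hc.smul_le hf (f⁻¹ • x)

/-- The orbit decreases to a fixed point below 1, and 0 is the only one. -/
theorem tendsto_pow_smul (hc : LipschitzCocycle c) (hf : Contracts f) {x : unitInterval}
    (hx : x < 1) : Tendsto (fun n : ℕ => ((f ^ n • x : unitInterval) : ℝ)) atTop (𝓝 0) := by
  have hanti : Antitone fun n : ℕ => f ^ n • x := antitone_nat_of_succ_le fun n => by
    rw [pow_succ', mul_smul]; exact hc.smul_le hf _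
  have ht := tendsto_atTop_iInf hanti
  set L := ⨅ n : ℕ, f ^ n • x with hL
  have hfix : f • L = L := by
    have h1 := ((hc.continuous_smul f).tendsto L).comp ht
    have h2 := ht.comp (tendsto_add_atTop_nat 1)
    refine tendsto_nhds_unique h1 (h2.congr fun n => ?_)
    simp [pow_succ', mul_smul]
  have hL1 : L < 1 := ((iInf_le _ 0).trans (by simp)).trans_lt hx
  have hL0 : L = 0 := by
    rcases (unitInterval.nonneg' : 0 ≤ L).eq_or_lt with h | h
    · exact h.symm
    · exact absurd hfix (hf L h hL1).ne
  rw [hL0] at ht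
  exact (continuous_subtype_val.tendsto _).comp ht

theorem tendsto_inv_pow_smul (hc : LipschitzCocycle c) (hf : Contracts f) {x : unitInterval}
    (hx : 0 < x) : Tendsto (fun n : ℕ => ((f⁻¹ ^ n • x : unitInterval) : ℝ)) atTop (𝓝 1) := by
  have hmono : Monotone fun n : ℕ => f⁻¹ ^ n • x := monotone_nat_of_le_succ fun n => by
    rw [pow_succ', mul_smul]; exact hc.le_inv_smul hf _
  have ht := tendsto_atTop_iSup hmono
  set L := ⨆ n : ℕ, f⁻¹ ^ n • x with hL
  have hfix : f⁻¹ • L = L := by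
    have h1 := ((hc.continuous_smul f⁻¹).tendsto L).comp ht
    have h2 := ht.comp (tendsto_add_atTop_nat 1)
    refine tendsto_nhds_unique h1 (h2.congr fun n => ?_)
    simp only [Function.comp_apply, pow_succ', mul_smul]
  have hL0 : 0 < L := hx.trans_le (le_trans (by simp) (le_iSup (fun n : ℕ => f⁻¹ ^ n • x) 0))
  have hL1 : L = 1 := by
    rcases (unitInterval.le_one' : L ≤ 1).eq_or_lt with h | h
    · exact h
    · exact absurd (inv_smul_eq_iff.1 hfix).symm (hf L hL0 h).ne
  rw [hL1] at ht
  exact (continuous_subtype_val.tendsto _).comp ht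

theorem exists_pow_smul_le (hc : LipschitzCocycle c) (hf : Contracts f) {z w : unitInterval}
    (hz : 0 < z) (hw : w < 1) : ∃ K : ℕ, f ^ K • w ≤ z := by
  have hz' : (0 : ℝ) < z := hz
  obtain ⟨K, hK⟩ := ((hc.tendsto_pow_smul hf hw).eventually (gt_mem_nhds hz')).exists
  exact ⟨K, (show f ^ K • w < z from hK).le⟩

theorem map_one (hc : LipschitzCocycle c) (x : unitInterval) : c 1 x = 0 := by
  have := hc.map_mul 1 1 x
  simp at this
  exact this

theorem map_inv (hc : LipschitzCocycle c) (a : Γ) (x : unitInterval) :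
    c a⁻¹ (a • x) = -c a x := by
  have := hc.map_mul a⁻¹ a x
  rw [inv_mul_cancel, hc.map_one] at this
  linarith

/-- Increments of `c (f ^ n)` are controlled by the monotone functions `x ↦ ∑ f ^ i x`. -/
theorem abs_pow_sub_le (hc : LipschitzCocycle c) {C : ℝ}
    (hC : ∀ u v, |c f u - c f v| ≤ C * |(u : ℝ) - v|) (n : ℕ) {u v : unitInterval} (h : u ≤ v) :
    |c (f ^ n) u - c (f ^ n) v| ≤
      C * ∑ i ∈ Finset.range n, (((f ^ i • v : unitInterval) : ℝ) - (f ^ i • u : unitInterval)) := by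
  induction n with
  | zero => simp [hc.map_one]
  | succ n ih =>
    rw [Finset.sum_range_succ, mul_add, pow_succ', hc.map_mul, hc.map_mul]
    have h1 := hC (f ^ n • u) (f ^ n • v)
    rw [abs_sub_comm ((f ^ n • u : unitInterval) : ℝ), abs_of_nonneg (sub_nonneg.2
      (show ((f ^ n • u : unitInterval) : ℝ) ≤ _ from hc.mono (f ^ n) h))] at h1
    calc _ = |(c (f ^ n) u - c (f ^ n) v) + (c f (f ^ n • u) - c f (f ^ n • v))| := by
            congr 1; ring
      _ ≤ _ := (abs_add_le _ _).trans (add_le_add ih h1)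

/-- Commutation carries `f ^ K • w ≤ z` over to the interval `[a • z, a • w]`, whose images then
overlap at most `K` times. The bound is uniform in `n` and small when `a` pushes `w` near 0; `a`
will be a power of `g` or of `f`. -/
theorem abs_pow_sub_le_left (hc : LipschitzCocycle c) (hf : Contracts f) {C : ℝ} (hC0 : 0 ≤ C)
    (hC : ∀ u v, |c f u - c f v| ≤ C * |(u : ℝ) - v|) {K : ℕ} {z w : unitInterval}
    (hzw : z ≤ w) (hK : f ^ K • w ≤ z) {a : Γ} (ha : Commute f a) (n : ℕ) :
    |c (f ^ n) (a • z) - c (f ^ n) (a • w)| ≤ C * (K * ((a • w : unitInterval) : ℝ)) := by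
  refine (hc.abs_pow_sub_le hC n (hc.mono a hzw)).trans (mul_le_mul_of_nonneg_left ?_ hC0)
  calc _ ≤ ∑ i ∈ Finset.range n, (((f ^ i • a • w : unitInterval) : ℝ)
          - (f ^ (i + K) • a • w : unitInterval)) := by
        refine Finset.sum_le_sum fun i _ => sub_le_sub_left ?_ _
        change f ^ (i + K) • a • w ≤ f ^ i • a • z
        rw [pow_add, mul_smul, ← mul_smul (f ^ K) a, (ha.pow_left K).eq, mul_smul]
        exact hc.mono _ (hc.mono _ hK)
    _ ≤ ∑ i ∈ Finset.range K, ((f ^ i • a • w : unitInterval) : ℝ) :=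
        sum_range_sub_shift_le (d := fun i => ((f ^ i • a • w : unitInterval) : ℝ))
          (fun i => (f ^ i • a • w).2.1) K n
    _ ≤ ∑ _i ∈ Finset.range K, ((a • w : unitInterval) : ℝ) := by
        refine Finset.sum_le_sum fun i _ => ?_
        change f ^ i • a • w ≤ a • w
        induction i with
        | zero => simp
        | succ i ih => rw [pow_succ', mul_smul]; exact (hc.smul_le hf _).trans (ih (by simp_all; omega))
    _ = _ := by simp

theorem abs_inv_pow_sub_le_right (hc : LipschitzCocycle c) (hf : Contracts f) {C : ℝ} (hC0 : 0 ≤ C)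
    (hC : ∀ u v, |c f⁻¹ u - c f⁻¹ v| ≤ C * |(u : ℝ) - v|) {K : ℕ} {z w : unitInterval}
    (hzw : z ≤ w) (hK : f ^ K • w ≤ z) {a : Γ} (ha : Commute f a) (n : ℕ) :
    |c (f⁻¹ ^ n) (a • z) - c (f⁻¹ ^ n) (a • w)| ≤ C * (K * (1 - ((a • z : unitInterval) : ℝ))) := by
  refine (hc.abs_pow_sub_le hC n (hc.mono a hzw)).trans (mul_le_mul_of_nonneg_left ?_ hC0)
  have hK' : w ≤ f⁻¹ ^ K • z := by
    have := hc.mono (f⁻¹ ^ K) hK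
    rwa [inv_pow, inv_smul_smul, ← inv_pow] at this
  calc _ ≤ ∑ i ∈ Finset.range n, ((1 - ((f⁻¹ ^ i • a • z : unitInterval) : ℝ))
          - (1 - ((f⁻¹ ^ (i + K) • a • z : unitInterval) : ℝ))) := by
        refine Finset.sum_le_sum fun i _ => ?_
        have : ((f⁻¹ ^ i • a • w : unitInterval) : ℝ) ≤ (f⁻¹ ^ (i + K) • a • z : unitInterval) := by
          change f⁻¹ ^ i • a • w ≤ f⁻¹ ^ (i + K) • a • z
          rw [pow_add, mul_smul, ← mul_smul (f⁻¹ ^ K) a, (ha.inv_left.pow_left K).eq, mul_smul]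
          exact hc.mono _ (hc.mono _ hK')
        linarith
    _ ≤ ∑ i ∈ Finset.range K, (1 - ((f⁻¹ ^ i • a • z : unitInterval) : ℝ)) :=
        sum_range_sub_shift_le (d := fun i => 1 - ((f⁻¹ ^ i • a • z : unitInterval) : ℝ))
          (fun i => sub_nonneg.2 (f⁻¹ ^ i • a • z).2.2) K n
    _ ≤ ∑ _i ∈ Finset.range K, (1 - ((a • z : unitInterval) : ℝ)) := by
        refine Finset.sum_le_sum fun i _ => sub_le_sub_left ?_ _
        change a • z ≤ f⁻¹ ^ i • a • z
        induction i with
        | zero => simp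
        | succ i ih =>
          rw [pow_succ', mul_smul]; exact (ih (by simp_all; omega)).trans (hc.le_inv_smul hf _)
    _ = _ := by simp [mul_sub]

/-- Expand `c (a * b) = c (b * a)` both ways: comparing `a` with `b` on `[z, w]` reduces to their
increments on displaced intervals. -/
theorem pow_sub_pow_eq (hc : LipschitzCocycle c) {a b : Γ} (h : Commute a b) (z w : unitInterval) :
    (c a z - c a w) - (c b z - c b w) =
      (c a (b • z) - c a (b • w)) - (c b (a • z) - c b (a • w)) := by
  have h1 := hc.map_mul a b z
  have h2 := hc.map_mul a b w
  rw [h.eq, hc.map_mul] at h1 h2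
  linarith

/-- Commuting contractions have the same asymptotic distortion at both endpoints. -/
theorem tendsto_sub_of_commute (hc : LipschitzCocycle c) (hf : Contracts f) (hg : Contracts g)
    (hfg : Commute f g) {z w : unitInterval} (hz : 0 < z) (hw : w < 1) (hzw : z ≤ w) :
    Tendsto (fun n : ℕ => (c (f ^ n) z - c (f ^ n) w) - (c (g ^ n) z - c (g ^ n) w)) atTop (𝓝 0) ∧
    Tendsto (fun n : ℕ => (c (f⁻¹ ^ n) z - c (f⁻¹ ^ n) w) - (c (g⁻¹ ^ n) z - c (g⁻¹ ^ n) w))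
      atTop (𝓝 0) := by
  -- `K` and `C` do not depend on `n`, while `g ^ n • w` tends to 0.
  have key1 : ∀ {f g : Γ}, Contracts f → Contracts g → Commute f g →
      Tendsto (fun n : ℕ => c (f ^ n) (g ^ n • z) - c (f ^ n) (g ^ n • w)) atTop (𝓝 0) := by
    intro f g hf hg hfg
    obtain ⟨K, hK⟩ := hc.exists_pow_smul_le hf hz hw
    obtain ⟨C, hC0, hC⟩ := hc.lipschitz f
    refine squeeze_zero_norm
      (fun n => hc.abs_pow_sub_le_left hf hC0 hC hzw hK (hfg.pow_right n) n) ?_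
    simpa using ((hc.tendsto_pow_smul hg hw).const_mul (K : ℝ)).const_mul C
  have key2 : ∀ {f g : Γ}, Contracts f → Contracts g → Commute f g →
      Tendsto (fun n : ℕ => c (f⁻¹ ^ n) (g⁻¹ ^ n • z) - c (f⁻¹ ^ n) (g⁻¹ ^ n • w))
        atTop (𝓝 0) := by
    intro f g hf hg hfg
    obtain ⟨K, hK⟩ := hc.exists_pow_smul_le hf hz hw
    obtain ⟨C, hC0, hC⟩ := hc.lipschitz f⁻¹
    refine squeeze_zero_norm
      (fun n => hc.abs_inv_pow_sub_le_right hf hC0 hC hzw hK (hfg.inv_right.pow_right n) n) ?_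
    simpa using (((hc.tendsto_inv_pow_smul hg hz).const_sub 1).const_mul (K : ℝ)).const_mul C
  constructor
  · simp_rw [fun n : ℕ => hc.pow_sub_pow_eq (hfg.pow_pow n n) z w]
    simpa using (key1 hf hg hfg).sub (key1 hg hf hfg.symm)
  · simp_rw [fun n : ℕ => hc.pow_sub_pow_eq (hfg.inv_inv.pow_pow n n) z w]
    simpa using (key2 hf hg hfg).sub (key2 hg hf hfg.symm)

theorem balanced_of_commute (hc : LipschitzCocycle c) (hf : Contracts f) (hg : Contracts g)
    (hfg : Commute f g) (h : Balanced c f) : Balanced c g := by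
  refine balanced_of_le fun z w hz hw hzw => ?_
  obtain ⟨h1, h2⟩ := hc.tendsto_sub_of_commute hf hg hfg hz hw hzw
  have := ((h z w hz (hzw.trans_lt hw) (hz.trans_le hzw) hw).sub h1).add h2
  simp only [sub_zero, add_zero] at this
  exact this.congr fun n => by ring

end LipschitzCocycle
end Dynamics
-- Sublinear growth of the variation is equivalent to balance
section Variation

variable {Γ : Type*} [Group Γ] [MulAction Γ unitInterval] {c : Γ → unitInterval → ℝ} {f g : Γ}

namespace LipschitzCocycle

/-- Since `f • w ≤ z`, the intervals `f⁻¹ ^ m • [z, w]` have disjoint interiors and are ordered from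
left to right. -/
theorem sum_edist_le_eVariationOn (hc : LipschitzCocycle c) (φ : unitInterval → ℝ)
    {z w : unitInterval} (hzw : z ≤ w) (hw : f • w ≤ z) (n : ℕ) :
    ∑ m ∈ Finset.range n, edist (φ (f⁻¹ ^ m • z)) (φ (f⁻¹ ^ m • w)) ≤
      eVariationOn φ (Iic (f⁻¹ ^ n • z)) := by
  induction n with
  | zero => simp
  | succ n ih =>
    have h1 : f⁻¹ ^ n • z ≤ f⁻¹ ^ n • w := hc.mono _ hzw
    have h2 : f⁻¹ ^ n • w ≤ f⁻¹ ^ (n + 1) • z := by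
      rw [pow_succ, mul_smul]
      refine hc.mono _ ?_
      simpa using hc.mono f⁻¹ hw
    rw [Finset.sum_range_succ]
    calc _ ≤ eVariationOn φ (Iic (f⁻¹ ^ n • z)) +
            eVariationOn φ (Icc (f⁻¹ ^ n • z) (f⁻¹ ^ (n + 1) • z)) :=
          add_le_add ih (eVariationOn.edist_le φ ⟨le_rfl, h1.trans h2⟩ ⟨h1, h2⟩)
      _ ≤ eVariationOn φ (Iic (f⁻¹ ^ n • z) ∪ Icc (f⁻¹ ^ n • z) (f⁻¹ ^ (n + 1) • z)) :=
          eVariationOn.add_le_union _ fun x hx y hy => le_trans hx hy.1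
      _ ≤ _ := eVariationOn.mono _ (union_subset (Iic_subset_Iic.2 (h1.trans h2)) fun x hx => hx.2)

theorem pow_sub_inv_pow (hc : LipschitzCocycle c) (p q : ℕ) (z : unitInterval) :
    c (f ^ q) z - c (f⁻¹ ^ p) z = c (f ^ (q + p)) (f⁻¹ ^ p • z) := by
  have h1 := hc.map_inv (f⁻¹ ^ p) z
  rw [inv_pow, inv_inv] at h1
  rw [pow_add, hc.map_mul, inv_pow, smul_inv_smul, h1]
  ring

/-- If `var (c (f ^ n))` grows sublinearly, then the distortions at both endpoints agree on
fundamental domains. -/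
theorem tendsto_of_tendsto_eVariationOn_div (hc : LipschitzCocycle c) (hf : Contracts f)
    (h : Tendsto (fun n : ℕ => eVariationOn (c (f ^ n)) univ / n) atTop (𝓝 0))
    {z w : unitInterval} (hz : 0 < z) (hw : w < 1) (hzw : z ≤ w) (hfw : f • w ≤ z) :
    Tendsto (fun n : ℕ => (c (f ^ n) z - c (f ^ n) w) - (c (f⁻¹ ^ n) z - c (f⁻¹ ^ n) w))
      atTop (𝓝 0) := by
  obtain ⟨C, hC0, hC⟩ := hc.lipschitz f
  obtain ⟨C', hC0', hC'⟩ := hc.lipschitz f⁻¹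
  -- Separate indices are needed: by `pow_sub_inv_pow`, `D p q` is the increment of `c (f ^ (q +
  -- p))` over the interval `f⁻¹ ^ p • [z, w]`.
  set D : ℕ → ℕ → ℝ := fun p q =>
    (c (f ^ q) z - c (f ^ q) w) - (c (f⁻¹ ^ p) z - c (f⁻¹ ^ p) w) with hD
  set ε : ℕ → ℝ := fun N => C * ((f ^ N • w : unitInterval) : ℝ) +
    C' * (1 - ((f⁻¹ ^ N • z : unitInterval) : ℝ)) with hε
  have hεlim : Tendsto ε atTop (𝓝 0) := by
    have := ((hc.tendsto_pow_smul hf hw).const_mul C).add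
      (((hc.tendsto_inv_pow_smul hf hz).const_sub 1).const_mul C')
    simpa only [sub_self, mul_zero, add_zero] using this
  have hK : f ^ 1 • w ≤ z := by simpa using hfw
  -- Past time `N` the orbits of `[z, w]` stay near the endpoints, so both distortions together
  -- change by at most `ε N`.
  have hcauchy : ∀ N p q, N ≤ p → N ≤ q → |D N N| - ε N ≤ |D p q| := by
    intro N p q hp hq
    obtain ⟨p, rfl⟩ := Nat.exists_eq_add_of_le' hp
    obtain ⟨q, rfl⟩ := Nat.exists_eq_add_of_le' hq
    have h1 := hc.abs_pow_sub_le_left hf hC0 hC hzw hK ((Commute.refl f).pow_right N) q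
    have h2 := hc.abs_inv_pow_sub_le_right hf hC0' hC' hzw hK
      ((Commute.refl f).inv_right.pow_right N) p
    have h3 : D (p + N) (q + N) = D N N +
        ((c (f ^ q) (f ^ N • z) - c (f ^ q) (f ^ N • w)) -
          (c (f⁻¹ ^ p) (f⁻¹ ^ N • z) - c (f⁻¹ ^ p) (f⁻¹ ^ N • w))) := by
      simp only [hD, pow_add, hc.map_mul]
      ring
    have h4 := abs_sub (c (f ^ q) (f ^ N • z) - c (f ^ q) (f ^ N • w))
      (c (f⁻¹ ^ p) (f⁻¹ ^ N • z) - c (f⁻¹ ^ p) (f⁻¹ ^ N • w))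
    have h5 := abs_sub (D (p + N) (q + N)) (D (p + N) (q + N) - D N N)
    rw [sub_sub_cancel, sub_eq_of_eq_add' h3] at h5
    simp only [Nat.cast_one, one_mul] at h1 h2
    simp only [hε]
    linarith
  have hle : ∀ N, |D N N| ≤ ε N := by
    intro N
    by_contra! hlt
    set r := |D N N| - ε N with hr
    have hr0 : 0 < r := sub_pos.2 hlt
    -- For `N ≤ m < N + M` the complementary exponent `2 * N + M - m` is also at least `N`, so each
    -- of these `M` translates contributes at least `r`.
    have hbound : ∀ M : ℕ, ENNReal.ofReal (M * r) ≤
        eVariationOn (c (f ^ (2 * N + M))) univ := by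
      intro M
      calc ENNReal.ofReal (M * r) = ∑ _m ∈ Finset.Ico N (N + M), ENNReal.ofReal r := by
            rw [Finset.sum_const, Nat.card_Ico, Nat.add_sub_cancel_left, nsmul_eq_mul,
              ENNReal.ofReal_mul (Nat.cast_nonneg M), ENNReal.ofReal_natCast]
        _ ≤ ∑ m ∈ Finset.Ico N (N + M), edist (c (f ^ (2 * N + M)) (f⁻¹ ^ m • z))
              (c (f ^ (2 * N + M)) (f⁻¹ ^ m • w)) := by
            refine Finset.sum_le_sum fun m hm => ?_
            rw [Finset.mem_Ico] at hm
            obtain ⟨q, hq⟩ := Nat.exists_eq_add_of_le' (show m ≤ 2 * N + M by omega)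
            rw [hq, ← hc.pow_sub_inv_pow, ← hc.pow_sub_inv_pow, edist_dist, Real.dist_eq]
            refine ENNReal.ofReal_le_ofReal ((hcauchy N m q (by omega) (by omega)).trans_eq ?_)
            simp only [hD]
            congr 1
            ring
        _ ≤ ∑ m ∈ Finset.range (N + M), edist (c (f ^ (2 * N + M)) (f⁻¹ ^ m • z))
              (c (f ^ (2 * N + M)) (f⁻¹ ^ m • w)) := by
            refine Finset.sum_le_sum_of_subset fun m hm => ?_
            simp at hm ⊢
            omega
        _ ≤ _ := (hc.sum_edist_le_eVariationOn _ hzw hfw _).trans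
            (eVariationOn.mono _ (subset_univ _))
    have hev := h.eventually (gt_mem_nhds (ENNReal.ofReal_pos.2 (half_pos hr0)))
    obtain ⟨n₀, hn₀⟩ := eventually_atTop.1 hev
    -- With `M = 2 * N + n₀ + 1 > 2 * N`, the lower bound `M * r` exceeds `r / 2` times the exponent
    -- `2 * N + M`.
    have h1 := hn₀ (2 * N + (2 * N + n₀ + 1)) (by omega)
    have h2 := hbound (2 * N + n₀ + 1)
    rw [ENNReal.div_lt_iff (.inl (Nat.cast_ne_zero.2 (by omega)))
      (.inl (ENNReal.natCast_ne_top _))] at h1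
    have h3 := h2.trans_lt h1
    rw [← ENNReal.ofReal_natCast, ← ENNReal.ofReal_mul (half_pos hr0).le,
      ENNReal.ofReal_lt_ofReal_iff (by positivity)] at h3
    push_cast at h3
    nlinarith [(Nat.cast_nonneg n₀ : (0 : ℝ) ≤ n₀)]
  exact squeeze_zero_norm hle hεlim

/-- Increments add up, so `[z, w]` can be cut into pieces `[f • w, w]` and a remainder, each within
a fundamental domain. -/
theorem balanced_of_tendsto_eVariationOn_div (hc : LipschitzCocycle c) (hf : Contracts f)
    (h : Tendsto (fun n : ℕ => eVariationOn (c (f ^ n)) univ / n) atTop (𝓝 0)) :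
    Balanced c f := by
  refine balanced_of_le fun z w hz hw hzw => ?_
  obtain ⟨K, hK⟩ := hc.exists_pow_smul_le hf hz hw
  induction K generalizing w with
  | zero =>
    obtain rfl : z = w := le_antisymm hzw (by simpa using hK)
    simp
  | succ K ih =>
    rcases le_total (f • w) z with hfw | hfw
    · exact hc.tendsto_of_tendsto_eVariationOn_div hf h hz hw hzw hfw
    · have h1 := ih (f • w) (hc.smul_lt_one f hw) hfw (by rwa [← mul_smul, ← pow_succ])
      have h2 := hc.tendsto_of_tendsto_eVariationOn_div hf h (hc.smul_pos f (hz.trans_le hzw)) hw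
        (hc.smul_le hf w) le_rfl
      have h3 := h1.add h2
      rw [add_zero] at h3
      exact h3.congr fun n => by ring

theorem monotone_sum_pow_smul (hc : LipschitzCocycle c) (a b : Γ) (n : ℕ) :
    Monotone fun x : unitInterval =>
      ∑ i ∈ Finset.range n, ((a ^ i • b • x : unitInterval) : ℝ) :=
  fun _ _ hxy => Finset.sum_le_sum fun i _ => hc.mono (a ^ i) (hc.mono b hxy)

theorem eVariationOn_pow_le (hc : LipschitzCocycle c) {C : ℝ} (hC0 : 0 ≤ C)
    (hC : ∀ u v, |c f u - c f v| ≤ C * |(u : ℝ) - v|) (n : ℕ) (a b : unitInterval) :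
    eVariationOn (c (f ^ n)) (Icc a b) ≤ ENNReal.ofReal
      (C * ∑ i ∈ Finset.range n, (((f ^ i • b : unitInterval) : ℝ) - (f ^ i • a : unitInterval))) := by
  refine eVariationOn_le_of_tendsto (a := a) (b := b) (fun x hx => hx)
    (ψ := fun _ u v => c (f ^ n) u - c (f ^ n) v)
    (T := fun _ x => C * ∑ i ∈ Finset.range n, ((f ^ i • x : unitInterval) : ℝ)) ?_ ?_ ?_ ?_
  · intro _ x y hxy
    have := hc.monotone_sum_pow_smul f 1 n hxy
    simp only [one_smul] at this
    exact mul_le_mul_of_nonneg_left this hC0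
  · simp [Finset.sum_sub_distrib, mul_sub]
  · exact fun _ _ _ _ _ => tendsto_const_nhds
  · refine .of_forall fun _ u _ v _ huv => ?_
    rw [← mul_sub, ← Finset.sum_sub_distrib]
    exact hc.abs_pow_sub_le hC n huv

/-- The variation of `c (f ^ n)` on the long middle part of the interval, for balanced `f`. -/
theorem eVariationOn_pow_le_of_balanced (hc : LipschitzCocycle c)
    (h : Balanced c f) {C C' : ℝ} (hC0 : 0 ≤ C) (hC0' : 0 ≤ C')
    (hC : ∀ u v, |c f u - c f v| ≤ C * |(u : ℝ) - v|)
    (hC' : ∀ u v, |c f⁻¹ u - c f⁻¹ v| ≤ C' * |(u : ℝ) - v|)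
    {y : unitInterval} (hy0 : 0 < y) (hy1 : y < 1) (n : ℕ) :
    eVariationOn (c (f ^ n)) (Icc y (f⁻¹ ^ n • y)) ≤ ENNReal.ofReal
      (C * ∑ i ∈ Finset.range n, ((f ^ i • y : unitInterval) : ℝ) +
        C' * ∑ i ∈ Finset.range n, (1 - ((f⁻¹ ^ i • y : unitInterval) : ℝ))) := by
  -- Balance at time `N + n` replaces the increment of `c (f ^ (N + n))` by that of `c (f⁻¹ ^ (N +
  -- n))`; removing the last `N` steps leaves that of `c (f ^ n)` in the limit.
  refine eVariationOn_le_of_tendsto (a := y) (b := f⁻¹ ^ n • y) (fun x hx => hx)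
    (ψ := fun N u v => (c (f⁻¹ ^ (N + n)) u - c (f⁻¹ ^ (N + n)) v) -
      (c (f ^ N) (f ^ n • u) - c (f ^ N) (f ^ n • v)))
    (T := fun N x => C * ∑ i ∈ Finset.range N, ((f ^ i • f ^ n • x : unitInterval) : ℝ) +
      C' * ∑ i ∈ Finset.range (N + n), ((f⁻¹ ^ i • x : unitInterval) : ℝ)) ?_ ?_ ?_ ?_
  · intro N
    have h1 := (hc.monotone_sum_pow_smul f (f ^ n) N).const_mul hC0
    have h2 := (hc.monotone_sum_pow_smul f⁻¹ 1 (N + n)).const_mul hC0'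
    simp only [one_smul] at h2
    exact h1.add h2
  -- Passing from `y` to `f⁻¹ ^ n • y` shifts each orbit sum by `n` places, so the increment of `T
  -- N` telescopes to a bound free of `N`.
  · refine .of_forall fun N => ?_
    have h1 := sum_range_sub_shift_le (d := fun i => ((f ^ i • y : unitInterval) : ℝ))
      (fun i => (f ^ i • y).2.1) n N
    have h2 := sum_range_sub_shift_le (d := fun i => 1 - ((f⁻¹ ^ i • y : unitInterval) : ℝ))
      (fun i => sub_nonneg.2 (f⁻¹ ^ i • y).2.2) n (N + n)
    simp only [sub_sub_sub_cancel_left] at h2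
    rw [Finset.sum_sub_distrib] at h1 h2
    have h3 : f ^ n • f⁻¹ ^ n • y = y := by rw [inv_pow, smul_inv_smul]
    simp only [h3, ← mul_smul, ← pow_add]
    have h4 := mul_le_mul_of_nonneg_left h1 hC0
    have h5 := mul_le_mul_of_nonneg_left h2 hC0'
    rw [mul_sub] at h4 h5
    linarith
  · intro u hu v hv huv
    have hn1 : f⁻¹ ^ n • y < 1 := hc.smul_lt_one _ hy1
    have h1 := (h u v (hy0.trans_le hu.1) (hu.2.trans_lt hn1) (hy0.trans_le hv.1)
      (hv.2.trans_lt hn1)).comp (tendsto_add_atTop_nat n)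
    have h2 := h1.const_sub (c (f ^ n) u - c (f ^ n) v)
    rw [sub_zero] at h2
    refine h2.congr fun N => ?_
    simp only [Function.comp_apply]
    rw [pow_add f N n, hc.map_mul, hc.map_mul]
    ring
  · refine .of_forall fun N u _ v _ huv => ?_
    have h1 := hc.abs_pow_sub_le hC N (hc.mono (f ^ n) huv)
    have h2 := hc.abs_pow_sub_le hC' (N + n) huv
    rw [Finset.sum_sub_distrib, mul_sub] at h1 h2
    refine (abs_sub _ _).trans ?_
    linarith

theorem eVariationOn_univ_le (φ : unitInterval → ℝ) {a b : unitInterval} (hab : a ≤ b) :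
    eVariationOn φ univ ≤ eVariationOn φ (Icc 0 a) + eVariationOn φ (Icc a b) +
      eVariationOn φ (Icc b 1) := by
  have h0 : (0 : unitInterval) ≤ a := unitInterval.nonneg'
  have h1 : b ≤ (1 : unitInterval) := unitInterval.le_one'
  have hu : (univ : Set unitInterval) = Icc 0 1 := by
    ext x; simp [unitInterval.le_one']
  have e1 := eVariationOn.Icc_add_Icc φ h0 (hab.trans h1) (mem_univ a)
  have e2 := eVariationOn.Icc_add_Icc φ hab h1 (mem_univ b)
  simp only [univ_inter] at e1 e2
  rw [hu, ← e1, ← e2, add_assoc]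

theorem tendsto_eVariationOn_div_of_balanced (hc : LipschitzCocycle c) (hf : Contracts f)
    (h : Balanced c f) :
    Tendsto (fun n : ℕ => eVariationOn (c (f ^ n)) univ / n) atTop (𝓝 0) := by
  obtain ⟨C, hC0, hC⟩ := hc.lipschitz f
  obtain ⟨C', hC0', hC'⟩ := hc.lipschitz f⁻¹
  obtain ⟨y, hy0, hy1⟩ : ∃ y : unitInterval, 0 < y ∧ y < 1 := exists_between zero_lt_one
  set A : ℕ → ℝ := fun n => ∑ i ∈ Finset.range n, ((f ^ i • y : unitInterval) : ℝ) with hA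
  set B : ℕ → ℝ := fun n => ∑ i ∈ Finset.range n, (1 - ((f⁻¹ ^ i • y : unitInterval) : ℝ)) with hB
  set B' : ℕ → ℝ := fun n =>
    ∑ i ∈ Finset.range n, (1 - ((f⁻¹ ^ (i + 1) • y : unitInterval) : ℝ)) with hB'
  have hA0 : ∀ n, 0 ≤ A n := fun n => Finset.sum_nonneg fun i _ => (f ^ i • y).2.1
  have hB0 : ∀ n, 0 ≤ B n := fun n => Finset.sum_nonneg fun i _ => sub_nonneg.2 (f⁻¹ ^ i • y).2.2
  have hB0' : ∀ n, 0 ≤ B' n :=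
    fun n => Finset.sum_nonneg fun i _ => sub_nonneg.2 (f⁻¹ ^ (i + 1) • y).2.2
  have hle : ∀ n, eVariationOn (c (f ^ n)) univ ≤
      ENNReal.ofReal (C * A n + (C * A n + C' * B n) + C * B' n) := by
    intro n
    have hyn : y ≤ f⁻¹ ^ n • y := by
      induction n with
      | zero => simp
      | succ n ih => rw [pow_succ', mul_smul]; exact ih.trans (hc.le_inv_smul hf _)
    refine (eVariationOn_univ_le _ hyn).trans ?_
    have n1 := mul_nonneg hC0 (hA0 n)
    have n2 := mul_nonneg hC0' (hB0 n)
    have n3 := mul_nonneg hC0 (hB0' n)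
    rw [ENNReal.ofReal_add (by positivity) n3, ENNReal.ofReal_add n1 (by positivity)]
    refine add_le_add (add_le_add ?_ ?_) ?_
    · refine (hc.eVariationOn_pow_le hC0 hC n 0 y).trans_eq ?_
      simp [hc.smul_zero, hA]
    · exact hc.eVariationOn_pow_le_of_balanced h hC0 hC0' hC hC' hy0 hy1 n
    · refine (hc.eVariationOn_pow_le hC0 hC n _ 1).trans_eq ?_
      -- The points `f ^ i • f⁻¹ ^ n • y` are `f⁻¹ ^ (n - i) • y`, with exponents running from `n`
      -- down to 1; hence the shift in `B'`.
      rw [hB', ← Finset.sum_range_reflect]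
      congr 2
      refine Finset.sum_congr rfl fun i hi => ?_
      have hi' := Finset.mem_range.1 hi
      obtain ⟨j, rfl⟩ := Nat.exists_eq_add_of_lt hi'
      rw [show i + j + 1 - 1 - i = j by omega, show i + j + 1 = j + (i + 1) by omega, hc.smul_one,
        pow_add, mul_smul, inv_pow f j, smul_inv_smul]
      rfl
  -- The terms of each sum tend to 0, hence so do their Cesàro means.
  have hAlim := (hc.tendsto_pow_smul hf hy1).cesaro
  have hBlim := ((hc.tendsto_inv_pow_smul hf hy0).const_sub 1).cesaro
  have hBlim' := (((hc.tendsto_inv_pow_smul hf hy0).const_sub 1).comp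
    (tendsto_add_atTop_nat 1)).cesaro
  have hlim : Tendsto (fun n : ℕ => ENNReal.ofReal
      ((C * A n + (C * A n + C' * B n) + C * B' n) / n)) atTop (𝓝 0) := by
    rw [← ENNReal.ofReal_zero]
    refine ENNReal.tendsto_ofReal ?_
    have := ((hAlim.const_mul C).add ((hAlim.const_mul C).add (hBlim.const_mul C'))).add
      (hBlim'.const_mul C)
    simp only [sub_self, mul_zero, add_zero] at this
    refine this.congr fun n => ?_
    simp only [hA, hB, hB', Function.comp_apply]
    ring
  refine tendsto_of_tendsto_of_tendsto_of_le_of_le' tendsto_const_nhds hlim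
    (.of_forall fun _ => zero_le) ?_
  filter_upwards [eventually_gt_atTop 0] with n hn
  rw [ENNReal.ofReal_div_of_pos (by positivity), ENNReal.ofReal_natCast]
  exact ENNReal.div_le_div_right (hle n) _

theorem tendsto_eVariationOn_div_of_commute (hc : LipschitzCocycle c) (hf : Contracts f)
    (hg : Contracts g) (hfg : Commute f g)
    (h : Tendsto (fun n : ℕ => eVariationOn (c (f ^ n)) univ / n) atTop (𝓝 0)) :
    Tendsto (fun n : ℕ => eVariationOn (c (g ^ n)) univ / n) atTop (𝓝 0) :=
  hc.tendsto_eVariationOn_div_of_balanced hg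
    (hc.balanced_of_commute hf hg hfg (hc.balanced_of_tendsto_eVariationOn_div hf h))

theorem eVariationOn_comp_smul (hc : LipschitzCocycle c) (φ : unitInterval → ℝ) (a : Γ) :
    eVariationOn (fun x => φ (a • x)) univ = eVariationOn φ univ := by
  have := eVariationOn.comp_eq_of_monotoneOn φ (fun x : unitInterval => a • x)
    ((hc.strictMono a).monotone.monotoneOn univ)
  rwa [image_univ, (MulAction.surjective a).range_eq] at this

theorem eVariationOn_inv (hc : LipschitzCocycle c) (a : Γ) :
    eVariationOn (c a⁻¹) univ = eVariationOn (c a) univ := by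
  rw [← hc.eVariationOn_comp_smul (c a⁻¹) a]
  simp only [hc.map_inv, eVariationOn, edist_neg_neg]

theorem eVariationOn_mul_le (hc : LipschitzCocycle c) (a b : Γ) :
    eVariationOn (c (a * b)) univ ≤ eVariationOn (c a) univ + eVariationOn (c b) univ := by
  rw [← hc.eVariationOn_comp_smul (c a) b]
  refine iSup_le fun p => ?_
  refine le_trans ?_ (add_le_add (le_iSup_of_le p le_rfl) (le_iSup_of_le p le_rfl))
  rw [← Finset.sum_add_distrib]
  refine Finset.sum_le_sum fun i _ => ?_
  simp only [hc.map_mul]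
  exact edist_add_add_le _ _ _ _

theorem eVariationOn_ne_top (hc : LipschitzCocycle c) (a : Γ) :
    eVariationOn (c a) univ ≠ ∞ := by
  obtain ⟨C, hC0, hC⟩ := hc.lipschitz a
  have h := hc.eVariationOn_pow_le (f := a) hC0 hC 1 0 1
  have hu : (univ : Set unitInterval) = Icc 0 1 := by
    ext x; simp [unitInterval.le_one']
  rw [hu]
  rw [pow_one] at h
  exact ne_top_of_le_ne_top ENNReal.ofReal_ne_top h

/-- Fekete's lemma: the cocycle relation makes the variation subadditive, and the Lipschitz bound
makes it finite. -/
theorem exists_tendsto_eVariationOn_div (hc : LipschitzCocycle c) (a : Γ) :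
    ∃ L : ℝ≥0∞, L < ∞ ∧ Tendsto (fun n : ℕ => eVariationOn (c (a ^ n)) univ / n) atTop (𝓝 L) := by
  have hsub : Subadditive fun n : ℕ => (eVariationOn (c (a ^ n)) univ).toReal := fun m n => by
    beta_reduce
    rw [← ENNReal.toReal_add (hc.eVariationOn_ne_top _) (hc.eVariationOn_ne_top _), pow_add]
    exact ENNReal.toReal_mono
      (ENNReal.add_ne_top.2 ⟨hc.eVariationOn_ne_top _, hc.eVariationOn_ne_top _⟩)
      (hc.eVariationOn_mul_le _ _)
  have hlim := hsub.tendsto_lim ⟨0, by rintro _ ⟨n, rfl⟩; positivity⟩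
  refine ⟨ENNReal.ofReal hsub.lim, ENNReal.ofReal_lt_top, ?_⟩
  refine (ENNReal.tendsto_ofReal hlim).congr' ?_
  filter_upwards [eventually_gt_atTop 0] with n hn
  rw [ENNReal.ofReal_div_of_pos (by positivity), ENNReal.ofReal_natCast,
    ENNReal.ofReal_toReal (hc.eVariationOn_ne_top _)]

end LipschitzCocycle
end Variation
-- The logarithmic derivative as a Lipschitz cocycle
section Diffeo

/-- The extension of an increasing bijection of `[0,1]` to the real line, constant on each side. -/
noncomputable def extendIso (a : unitInterval ≃o unitInterval) (x : ℝ) : ℝ :=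
  a (projIcc 0 1 zero_le_one x)

theorem extendIso_coe (a : unitInterval ≃o unitInterval) (x : unitInterval) :
    extendIso a x = a x := by
  simp [extendIso]

theorem extendIso_mem (a : unitInterval ≃o unitInterval) (x : ℝ) :
    extendIso a x ∈ Icc (0 : ℝ) 1 :=
  (a (projIcc 0 1 zero_le_one x)).2

theorem extendIso_mul (a b : unitInterval ≃o unitInterval) :
    extendIso (a * b) = extendIso a ∘ extendIso b := by
  ext x
  simp [extendIso]

theorem eqOn_extendIso_one : EqOn (extendIso 1) id (Icc 0 1) :=
  fun x hx => extendIso_coe 1 ⟨x, hx⟩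

/-- The group of increasing `C^2` diffeomorphisms of `[0,1]`. -/
def diffeoGroup : Subgroup (unitInterval ≃o unitInterval) where
  carrier := {a | ContDiffOn ℝ 2 (extendIso a) (Icc 0 1) ∧ ContDiffOn ℝ 2 (extendIso a⁻¹) (Icc 0 1)}
  one_mem' := by
    have : ContDiffOn ℝ 2 (extendIso 1) (Icc 0 1) := contDiffOn_id.congr eqOn_extendIso_one
    exact ⟨this, by simpa using this⟩
  mul_mem' := by
    rintro a b ⟨ha, ha'⟩ ⟨hb, hb'⟩
    refine ⟨?_, ?_⟩
    · rw [extendIso_mul]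
      exact ha.comp hb fun x _ => extendIso_mem b x
    · rw [mul_inv_rev, extendIso_mul]
      exact hb'.comp ha' fun x _ => extendIso_mem a⁻¹ x
  inv_mem' := by
    rintro a ⟨ha, ha'⟩
    exact ⟨ha', by rwa [inv_inv]⟩

/-- The cocycle `a ↦ log Da`. -/
noncomputable def logDerivCocycle (a : diffeoGroup) (x : unitInterval) : ℝ :=
  Real.log (derivWithin (extendIso a) (Icc 0 1) x)

theorem derivWithin_extendIso_mul (a b : diffeoGroup) (x : unitInterval) :
    derivWithin (extendIso (a * b : diffeoGroup)) (Icc 0 1) x =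
      derivWithin (extendIso a) (Icc 0 1) (b • x : unitInterval) *
        derivWithin (extendIso b) (Icc 0 1) x := by
  have hb : extendIso b x = (b • x : unitInterval) := extendIso_coe _ x
  rw [Subgroup.coe_mul, extendIso_mul, derivWithin_comp (x : ℝ) (s' := Icc 0 1) (h₂ := extendIso a), hb]
  · exact a.2.1.differentiableOn (by norm_num) _ (extendIso_mem _ _)
  · exact b.2.1.differentiableOn (by norm_num) _ x.2
  · exact fun y _ => extendIso_mem _ y

/-- Apply the chain rule to `a⁻¹ * a = 1`. -/
theorem derivWithin_extendIso_ne_zero (a : diffeoGroup) (x : unitInterval) :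
    derivWithin (extendIso a) (Icc 0 1) x ≠ 0 := by
  have h := derivWithin_extendIso_mul a⁻¹ a x
  rw [inv_mul_cancel, Subgroup.coe_one, derivWithin_congr eqOn_extendIso_one
    (eqOn_extendIso_one x.2), derivWithin_id _ _ (uniqueDiffOn_Icc zero_lt_one _ x.2)] at h
  exact right_ne_zero_of_mul (h ▸ one_ne_zero)

theorem lipschitzCocycle_logDerivCocycle : LipschitzCocycle logDerivCocycle where
  strictMono a := (a : unitInterval ≃o unitInterval).strictMono
  map_mul a b x := by
    rw [logDerivCocycle, derivWithin_extendIso_mul, Real.log_mul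
      (derivWithin_extendIso_ne_zero _ _) (derivWithin_extendIso_ne_zero _ _)]
    rfl
  lipschitz a := by
    -- This is where `C^2` enters: `log Da` is then `C^1` on a compact interval, hence Lipschitz.
    have h1 : ContDiffOn ℝ 1 (derivWithin (extendIso a) (Icc 0 1)) (Icc 0 1) :=
      a.2.1.derivWithin (uniqueDiffOn_Icc zero_lt_one) (by norm_num)
    have h2 := h1.log fun x hx => derivWithin_extendIso_ne_zero a ⟨x, hx⟩
    obtain ⟨K, hK⟩ := (h2.locallyLipschitzOn (convex_Icc 0 1)).exists_lipschitzOnWith_of_compact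
      isCompact_Icc
    refine ⟨K, K.2, fun u v => ?_⟩
    have := hK.dist_le_mul u u.2 v v.2
    rwa [Real.dist_eq, Real.dist_eq] at this

theorem IsDiffeo.exists_diffeoGroup {f : ℝ → ℝ} (hf : IsDiffeo 2 f) :
    ∃ a : diffeoGroup, ∀ x : unitInterval, f x = (a • x : unitInterval) := by
  obtain ⟨h, hinv, hh⟩ := hf.exists_contDiffOn_inverse
  set F : unitInterval → unitInterval := fun x => ⟨f x, hf.bijOn.mapsTo x.2⟩ with hF
  have hmono : StrictMono F := fun x y hxy => hf.strictMonoOn x.2 y.2 hxy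
  have hsurj : Function.Surjective F := fun y => by
    obtain ⟨x, hx, hxy⟩ := hf.bijOn.surjOn y.2
    exact ⟨⟨x, hx⟩, Subtype.ext hxy⟩
  set a := hmono.orderIsoOfSurjective F hsurj with ha
  have haF : ∀ x, a x = F x := fun x => rfl
  have e1 : EqOn (extendIso a) f (Icc 0 1) := fun x hx => extendIso_coe a ⟨x, hx⟩
  have e2 : EqOn (extendIso a⁻¹) h (Icc 0 1) := fun y hy => by
    obtain ⟨x, hx⟩ := hsurj ⟨y, hy⟩
    have hxy : f x = y := congrArg Subtype.val hx
    rw [show y = ((⟨y, hy⟩ : unitInterval) : ℝ) from rfl, extendIso_coe, ← hx]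
    change ((a.symm (a x) : unitInterval) : ℝ) = h (f x)
    rw [a.symm_apply_apply, hinv.1 x.2]
  exact ⟨⟨a, hf.contDiffOn.congr e1, hh.congr e2⟩, fun x => rfl⟩

theorem iterate_eq_smul {f : ℝ → ℝ} {a : diffeoGroup}
    (ha : ∀ x : unitInterval, f x = (a • x : unitInterval)) (n : ℕ) (x : unitInterval) :
    f^[n] x = (a ^ n • x : unitInterval) := by
  induction n with
  | zero => simp
  | succ n ih => rw [Function.iterate_succ_apply', ih, ha, pow_succ', mul_smul]

theorem distortionSeq_eq {f : ℝ → ℝ} {a : diffeoGroup}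
    (ha : ∀ x : unitInterval, f x = (a • x : unitInterval)) :
    distortionSeq f = fun n : ℕ => eVariationOn (logDerivCocycle (a ^ n)) univ / n := by
  ext n
  have e : EqOn f^[n] (extendIso (a ^ n : diffeoGroup)) (Icc 0 1) := fun x hx =>
    (iterate_eq_smul ha n ⟨x, hx⟩).trans (extendIso_coe _ ⟨x, hx⟩).symm
  rw [distortionSeq, varLogDeriv]
  congr 1
  have h := eVariationOn.comp_eq_of_monotoneOn
    (fun x => Real.log (derivWithin f^[n] (Icc 0 1) x)) (Subtype.val : unitInterval → ℝ)
    ((Subtype.mono_coe _).monotoneOn univ)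
  rw [image_univ, Subtype.range_val] at h
  refine h.symm.trans (congrArg (fun φ => eVariationOn φ univ) ?_)
  ext x
  simp only [Function.comp_apply, logDerivCocycle]
  rw [derivWithin_congr e (e x.2)]

theorem IsDiffeoDelta.contracts_or_contracts_inv {f : ℝ → ℝ} (hf : IsDiffeoDelta 2 f)
    {a : diffeoGroup} (ha : ∀ x : unitInterval, f x = (a • x : unitInterval)) :
    Contracts a ∨ Contracts a⁻¹ := by
  have hcont : ContinuousOn (fun x => f x - x) (Ioo 0 1) :=
    (hf.contDiffOn.continuousOn.mono Ioo_subset_Icc_self).sub continuousOn_id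
  by_contra! hcon
  simp only [Contracts, not_forall, not_lt] at hcon
  obtain ⟨⟨x, hx0, hx1, hx⟩, ⟨y, hy0, hy1, hy⟩⟩ := hcon
  have hc := lipschitzCocycle_logDerivCocycle
  have hy' : a • y ≤ y := by simpa using hc.mono a hy
  -- `f x - x` takes both signs in the weak sense, so it vanishes at an interior point.
  obtain ⟨z, hz, hz0⟩ := isPreconnected_Ioo.intermediate_value
    (show (y : ℝ) ∈ Ioo (0 : ℝ) 1 from ⟨hy0, hy1⟩) (show (x : ℝ) ∈ Ioo (0 : ℝ) 1 from ⟨hx0, hx1⟩)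
    hcont (show (0 : ℝ) ∈ Icc (f y - y) (f x - x) by
      rw [ha, ha]
      exact ⟨sub_nonpos.2 hy', sub_nonneg.2 hx⟩)
  exact hf.no_interior_fixed_point z hz (sub_eq_zero.1 hz0)

theorem exists_contracts_distortionSeq {f : ℝ → ℝ} (hf : IsDiffeoDelta 2 f)
    {a : diffeoGroup} (ha : ∀ x : unitInterval, f x = (a • x : unitInterval)) :
    ∃ b : diffeoGroup, Contracts b ∧ (b = a ∨ b = a⁻¹) ∧
      distortionSeq f = fun n : ℕ => eVariationOn (logDerivCocycle (b ^ n)) univ / n := by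
  rcases hf.contracts_or_contracts_inv ha with h | h
  · exact ⟨a, h, .inl rfl, distortionSeq_eq ha⟩
  · refine ⟨a⁻¹, h, .inr rfl, (distortionSeq_eq ha).trans ?_⟩
    simp only [inv_pow, lipschitzCocycle_logDerivCocycle.eVariationOn_inv]

end Diffeo
end IntervalDiffeo

/-! ### Conclusion for commuting diffeomorphisms -/

theorem corollaryD (f g : ℝ → ℝ)
    (hf : IntervalDiffeo.IsDiffeoDelta 2 f) (hg : IntervalDiffeo.IsDiffeoDelta 2 g)
    (hcomm : ∀ x ∈ Icc (0 : ℝ) 1, f (g x) = g (f x)) :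
    -- the limits defining both asymptotic distortions exist and are finite
    (Tendsto (IntervalDiffeo.distortionSeq f) atTop (𝓝 (IntervalDiffeo.asymptoticDistortion f)) ∧
      IntervalDiffeo.asymptoticDistortion f < ∞) ∧
    (Tendsto (IntervalDiffeo.distortionSeq g) atTop (𝓝 (IntervalDiffeo.asymptoticDistortion g)) ∧
      IntervalDiffeo.asymptoticDistortion g < ∞) ∧
    -- and they are either both zero or both positive
    ((IntervalDiffeo.asymptoticDistortion f = 0 ∧ IntervalDiffeo.asymptoticDistortion g = 0) ∨
      (0 < IntervalDiffeo.asymptoticDistortion f ∧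
        0 < IntervalDiffeo.asymptoticDistortion g)) := by
  have hc := IntervalDiffeo.lipschitzCocycle_logDerivCocycle
  obtain ⟨a, ha⟩ := hf.toIsDiffeo.exists_diffeoGroup
  obtain ⟨b, hb⟩ := hg.toIsDiffeo.exists_diffeoGroup
  have hab : Commute a b := by
    refine Subtype.ext (RelIso.ext fun x => Subtype.ext ?_)
    change ((a • b • x : unitInterval) : ℝ) = (b • a • x : unitInterval)
    rw [← ha, ← hb, ← hb, ← ha]
    exact hcomm x x.2
  obtain ⟨p, hp, hpa, hfp⟩ := IntervalDiffeo.exists_contracts_distortionSeq hf ha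
  obtain ⟨q, hq, hqb, hgq⟩ := IntervalDiffeo.exists_contracts_distortionSeq hg hb
  have hpq : Commute p q := by
    rcases hpa with rfl | rfl <;> rcases hqb with rfl | rfl <;> simpa using hab
  obtain ⟨L, hL, hLf⟩ := hc.exists_tendsto_eVariationOn_div p
  obtain ⟨M, hM, hMg⟩ := hc.exists_tendsto_eVariationOn_div q
  have hzero : L = 0 ↔ M = 0 := by
    constructor
    · rintro rfl
      exact tendsto_nhds_unique hMg (hc.tendsto_eVariationOn_div_of_commute hp hq hpq hLf)
    · rintro rfl
      exact tendsto_nhds_unique hLf (hc.tendsto_eVariationOn_div_of_commute hq hp hpq.symm hMg)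
  rw [← hfp] at hLf
  rw [← hgq] at hMg
  have eL : IntervalDiffeo.asymptoticDistortion f = L := hLf.limUnder_eq
  have eM : IntervalDiffeo.asymptoticDistortion g = M := hMg.limUnder_eq
  rw [eL, eM]
  refine ⟨⟨hLf, hL⟩, ⟨hMg, hM⟩, ?_⟩
  by_cases h : L = 0
  · exact .inl ⟨h, hzero.1 h⟩
  · exact .inr ⟨pos_iff_ne_zero.2 h, pos_iff_ne_zero.2 fun hM0 => h (hzero.2 hM0)⟩
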